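/- Let $\lambda>0$, $\rho>0$ and $-\lambda\le\beta\le\dfrac{\lambda}{e^{\rho}-1}$, and put $$G(t)=1-\frac{(1-e^{-\rho})(\lambda+\beta)}{\lambda e^{-\rho}\left(e^{(\lambda+\beta)t}-1\right)+\lambda}\quad(t\ge 0),\qquad G(t)=0\quad(t<0).$$ Then $G$ is a probability distribution function, and it satisfies the Riccati equation $G'(t)=-\lambda G(t)^2-(\beta-\lambda)G(t)+\beta$ for $t>0$. If $\beta>-\lambda$, then $\lambda\int_0^\infty[1-G(v)]\,dv=\rho$; if $\beta=-\lambda$, then $G(t)=1$ for all $t\ge 0$. Consider the $M|G|\infty$ queue: customers arrive according to a Poisson process of rate $\lambda$, their service lengths are i.i.d. with distribution function $G$ and independent of the arrivals, and every customer is served immediately on arrival. Let $B$ be the length of a busy period, that is, the time from the arrival of a customer at the empty system until the first instant at which no customer is in service (so $B=0$ if that customer has service length $0$). Then $B<\infty$ almost surely, and $$P(B\le t)=1-\frac{\lambda+\beta}{\lambda}\,(1-e^{-\rho})\,e^{-e^{-\rho}(\lambda+\beta)t},\qquad t\ge 0.$$ Moreover: 1. If $\beta>-\lambda$, put $p=\frac{\lambda+\beta}{\lambda}(1-e^{-\rho})$.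 Then $0<p\le 1$, and the law of $B$ is the mixture $(1-p)\,\delta_0+p\,\mathrm{Exp}\!\left(e^{-\rho}(\lambda+\beta)\right)$ of the point mass at the origin and an exponential law. 2. If $\beta=\frac{\lambda}{e^{\rho}-1}$, then $B$ is exponentially distributed with rate $\frac{\lambda}{e^{\rho}-1}$. 3. If $\beta=-\lambda$, then $B=0$ almost surely. -/

import Mathlib

open MeasureTheory ProbabilityTheory Set
open scoped NNReal ENNReal

namespace MGInfty

/-- The service length distribution function with parameters `lam`, `rho`, `beta`;
service lengths are nonnegative, so it vanishes on the negative half-line. -/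
noncomputable def serviceCDF (lam rho beta t : ℝ) : ℝ :=
  if 0 ≤ t then
    1 - (1 - Real.exp (-rho)) * (lam + beta) /
      (lam * Real.exp (-rho) * (Real.exp ((lam + beta) * t) - 1) + lam)
  else 0

variable {Ω : Type*}

/-- The arrival instant of customer `n`, when customer `0` arrives at time `0` and `T k` is the
time between the arrivals of customers `k` and `k + 1`. -/
def arrival (T : ℕ → Ω → ℝ) (n : ℕ) (ω : Ω) : ℝ := ∑ k ∈ Finset.range n, T k ω

/-- The number of customers being served at time `t`: there is always a free server, so customer
`n`, with service length `S n`, is in service exactly during `[arrival n, arrival n + S n)`. -/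
noncomputable def numInService (T S : ℕ → Ω → ℝ) (t : ℝ) (ω : Ω) : ℕ∞ :=
  Set.encard {n : ℕ | arrival T n ω ≤ t ∧ t < arrival T n ω + S n ω}

/-- The length of the busy period that begins at time `0` with the arrival of customer `0` at the
empty system: the first time at which nobody is in service (`∞` if there is no such time). -/
noncomputable def busyPeriod (T S : ℕ → Ω → ℝ) (ω : Ω) : ℝ≥0∞ :=
  ⨅ (t : ℝ≥0) (_ : numInService T S (t : ℝ) ω = 0), (t : ℝ≥0∞)

/-- The probabilistic assumptions of the `M|G|∞` queue, seen from an instant at which a busy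
period begins: Poisson arrivals at rate `lam`, i.e. i.i.d. exponential interarrival times `T`,
and i.i.d. service lengths `S` with distribution function `G`, independent of the arrivals. -/
structure IsQueue [MeasurableSpace Ω] (P : Measure Ω) (lam : ℝ) (G : ℝ → ℝ)
    (T S : ℕ → Ω → ℝ) : Prop where
  measurable_interarrival : ∀ n, Measurable (T n)
  measurable_service : ∀ n, Measurable (S n)
  interarrival_law : ∀ n, P.map (T n) = expMeasure lam
  service_law : ∀ n t, P.real {ω | S n ω ≤ t} = G t
  indep : iIndepFun (Sum.elim T S) P

end MGInfty

namespace MGInfty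

open Filter Topology

/-! Write q = exp(-rho), a = lam + beta and p(t) = q + (1 - q) exp(-a t). The service law is the G
with 1 - G = -p'/(lam p). When a > 0, integrating this logarithmic derivative gives the traffic
intensity rho, since p falls from 1 to q.

The busy period is handled by a martingale along the arrivals. After customer n the state is (d, x):
x is the arrival time of customer n, and d is the time at which the customers seen so far in the
first busy period have all left. `endProb` is an explicit bounded function of this state. Averaging
it over the service length of a new customer multiplies one exponential term by 1 - a/lam
(`integral_endProb_max`). Averaging over the exponential gap before that arrival removes the factor
again (`integral_endProb_nextEnd`). So the expectation of `endProb` does not depend on n.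

Arrivals tend to infinity almost surely, so `endProb` converges to the indicator that every due time
is at most t (`tendsto_endProb`). Pathwise this is the event B ≤ t (`busyPeriod_le_iff`). By
dominated convergence P(B ≤ t) equals the expectation at customer 0, which is 1 - (a/lam)(1 - q)
exp(-q a t). The laws of B are read off from this distribution function. -/

/-- The probability that the `M|G|∞` system with service law `serviceCDF`, started empty, is empty
at time `t`; here `q = exp (-rho)` and `a = lam + beta`. -/
noncomputable def idleProb (q a t : ℝ) : ℝ := q + (1 - q) * Real.exp (-(a * t))

section IdleProb

variable {q a : ℝ}

lemma idleProb_pos (hq : 0 < q) (hq1 : q ≤ 1) (t : ℝ) : 0 < idleProb q a t := by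
  have := mul_nonneg (sub_nonneg.2 hq1) (Real.exp_pos (-(a * t))).le
  unfold idleProb
  linarith

lemma hasDerivAt_exp_neg_mul (a t : ℝ) :
    HasDerivAt (fun t => Real.exp (-(a * t))) (-(a * Real.exp (-(a * t)))) t := by
  convert! (((hasDerivAt_id t).const_mul a).neg).exp using 1
  simp; ring

lemma hasDerivAt_idleProb (q a t : ℝ) :
    HasDerivAt (idleProb q a) (-(a * ((1 - q) * Real.exp (-(a * t))))) t := by
  convert! ((hasDerivAt_exp_neg_mul a t).const_mul (1 - q)).const_add q using 1
  ring

lemma continuous_idleProb (q a : ℝ) : Continuous (idleProb q a) := by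
  unfold idleProb; fun_prop

end IdleProb

/-! ### The service distribution: quotient form, Riccati equation, mean. -/

section ServiceCDF

variable {lam rho beta : ℝ}

lemma serviceCDF_of_neg {t : ℝ} (ht : t < 0) : serviceCDF lam rho beta t = 0 :=
  if_neg (not_le.2 ht)

lemma exp_neg_lt_one (hrho : 0 < rho) : Real.exp (-rho) < 1 := by
  rw [Real.exp_lt_one_iff]; linarith

/-- The service distribution function in terms of the idle probability. -/
lemma serviceCDF_eq (hlam : 0 < lam) (hrho : 0 < rho) {t : ℝ} (ht : 0 ≤ t) :
    serviceCDF lam rho beta t = 1 - (lam + beta) / lam * ((1 - Real.exp (-rho)) *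
      Real.exp (-((lam + beta) * t)) / idleProb (Real.exp (-rho)) (lam + beta) t) := by
  have hp : 0 < idleProb (Real.exp (-rho)) (lam + beta) t :=
    idleProb_pos (Real.exp_pos _) (exp_neg_lt_one hrho).le t
  have hE := Real.exp_pos ((lam + beta) * t)
  have hden : lam * Real.exp (-rho) * (Real.exp ((lam + beta) * t) - 1) + lam =
      lam * (idleProb (Real.exp (-rho)) (lam + beta) t * Real.exp ((lam + beta) * t)) := by
    unfold idleProb
    rw [Real.exp_neg ((lam + beta) * t)]
    field_simp
    ring
  rw [serviceCDF, if_pos ht, hden, Real.exp_neg ((lam + beta) * t)]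
  field_simp

/-- On the half-line t ≥ 0 this is the only property of G that the busy period computation uses:
multiplying p by G multiplies its exponential term by 1 - a/lam. -/
lemma serviceCDF_mul_idleProb (hlam : 0 < lam) (hrho : 0 < rho) {t : ℝ} (ht : 0 ≤ t) :
    serviceCDF lam rho beta t * idleProb (Real.exp (-rho)) (lam + beta) t =
      idleProb (Real.exp (-rho)) (lam + beta) t - (lam + beta) / lam *
        ((1 - Real.exp (-rho)) * Real.exp (-((lam + beta) * t))) := by
  have hp : 0 < idleProb (Real.exp (-rho)) (lam + beta) t :=
    idleProb_pos (Real.exp_pos _) (exp_neg_lt_one hrho).le t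
  rw [serviceCDF_eq hlam hrho ht]
  field_simp

lemma serviceCDF_zero (hlam : 0 < lam) (hrho : 0 < rho) :
    serviceCDF lam rho beta 0 = 1 - (lam + beta) / lam * (1 - Real.exp (-rho)) := by
  rw [serviceCDF_eq hlam hrho le_rfl]
  simp [idleProb]

lemma hasDerivAt_serviceCDF (hlam : 0 < lam) (hrho : 0 < rho) {t : ℝ} (ht : 0 < t) :
    HasDerivAt (serviceCDF lam rho beta)
      (-lam * serviceCDF lam rho beta t ^ 2 - (beta - lam) * serviceCDF lam rho beta t + beta)
      t := by
  have hp : 0 < idleProb (Real.exp (-rho)) (lam + beta) t :=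
    idleProb_pos (Real.exp_pos _) (exp_neg_lt_one hrho).le t
  have h := ((((hasDerivAt_exp_neg_mul (lam + beta) t).const_mul (1 - Real.exp (-rho))).div
    (hasDerivAt_idleProb (Real.exp (-rho)) (lam + beta) t) hp.ne').const_mul
      ((lam + beta) / lam)).const_sub 1
  have h' := h.congr_of_eventuallyEq (f₁ := serviceCDF lam rho beta) (by
    filter_upwards [lt_mem_nhds ht] with s hs
    exact serviceCDF_eq hlam hrho hs.le)
  convert! h' using 1
  rw [serviceCDF_eq hlam hrho ht.le]
  field_simp
  unfold idleProb
  ring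

/-- The upper bound on `beta` enters only here. It makes G(0) nonnegative and keeps the weight of
the exponential component at most 1. -/
lemma le_of_le_div_exp_sub_one (hlam : 0 < lam) (hrho : 0 < rho)
    (hbeta : beta ≤ lam / (Real.exp rho - 1)) :
    (lam + beta) / lam * (1 - Real.exp (-rho)) ≤ 1 := by
  have h1 : 0 < Real.exp rho - 1 := by linarith [Real.add_one_lt_exp hrho.ne']
  have he := Real.exp_pos rho
  rw [le_div_iff₀ h1] at hbeta
  rw [Real.exp_neg, div_mul_eq_mul_div, div_le_one hlam]
  have : (lam + beta) * (1 - (Real.exp rho)⁻¹) =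
      (lam + beta) * (Real.exp rho - 1) / Real.exp rho := by
    field_simp
  rw [this, div_le_iff₀ he]
  linarith

lemma serviceCDF_monotone (hlam : 0 < lam) (hrho : 0 < rho)
    (hbeta₁ : -lam ≤ beta) (hbeta₂ : beta ≤ lam / (Real.exp rho - 1)) :
    Monotone (serviceCDF lam rho beta) := by
  have ha : 0 ≤ lam + beta := by linarith
  have hq1 := exp_neg_lt_one hrho
  have hq := Real.exp_pos (-rho)
  have key : ∀ s t : ℝ, 0 ≤ s → s ≤ t →
      serviceCDF lam rho beta s ≤ serviceCDF lam rho beta t := by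
    intro s t hs hst
    rw [serviceCDF_eq hlam hrho hs, serviceCDF_eq hlam hrho (hs.trans hst)]
    gcongr 1 - (lam + beta) / lam * ?_
    have hps := idleProb_pos (a := lam + beta) hq hq1.le s
    have hpt := idleProb_pos (a := lam + beta) hq hq1.le t
    rw [div_le_div_iff₀ hpt hps]
    have hE : Real.exp (-((lam + beta) * t)) ≤ Real.exp (-((lam + beta) * s)) := by gcongr
    -- After cross-multiplication the products of the two exponentials cancel, and this is the
    -- difference that remains.
    have : 0 ≤ (1 - Real.exp (-rho)) * Real.exp (-rho) *
        (Real.exp (-((lam + beta) * s)) - Real.exp (-((lam + beta) * t))) :=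
      mul_nonneg (mul_nonneg (by linarith) hq.le) (by linarith)
    unfold idleProb
    linarith
  intro s t hst
  rcases lt_or_ge s 0 with hs | hs
  · rw [serviceCDF_of_neg hs]
    rcases lt_or_ge t 0 with ht | ht
    · rw [serviceCDF_of_neg ht]
    · refine le_trans ?_ (key 0 t le_rfl ht)
      rw [serviceCDF_zero hlam hrho]
      linarith [le_of_le_div_exp_sub_one hlam hrho hbeta₂]
  · exact key s t hs hst

lemma serviceCDF_continuousWithinAt (hlam : 0 < lam) (hrho : 0 < rho) (t : ℝ) :
    ContinuousWithinAt (serviceCDF lam rho beta) (Ici t) t := by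
  rcases lt_or_ge t 0 with ht | ht
  · have : serviceCDF lam rho beta =ᶠ[𝓝 t] fun _ => 0 := by
      filter_upwards [gt_mem_nhds ht] with s hs
      exact serviceCDF_of_neg hs
    exact (continuousAt_const.congr this.symm).continuousWithinAt
  · have hc : Continuous fun t => 1 - (lam + beta) / lam * ((1 - Real.exp (-rho)) *
        Real.exp (-((lam + beta) * t)) / idleProb (Real.exp (-rho)) (lam + beta) t) := by
      refine continuous_const.sub (continuous_const.mul (Continuous.div (by fun_prop)
        (continuous_idleProb _ _) fun t => ?_))
      exact (idleProb_pos (Real.exp_pos _) (exp_neg_lt_one hrho).le t).ne'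
    exact hc.continuousWithinAt.congr (fun s hs => serviceCDF_eq hlam hrho (ht.trans hs))
      (serviceCDF_eq hlam hrho ht)

lemma tendsto_exp_neg_mul_atTop {a : ℝ} (ha : 0 < a) :
    Tendsto (fun t => Real.exp (-(a * t))) atTop (𝓝 0) :=
  Real.tendsto_exp_neg_atTop_nhds_zero.comp (tendsto_id.const_mul_atTop ha)

lemma tendsto_idleProb_atTop {q a : ℝ} (ha : 0 < a) :
    Tendsto (idleProb q a) atTop (𝓝 q) := by
  have := ((tendsto_exp_neg_mul_atTop ha).const_mul (1 - q)).const_add q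
  rw [mul_zero, add_zero] at this
  exact this

lemma serviceCDF_eq_one (hlam : 0 < lam) (hrho : 0 < rho) (hbeta : beta = -lam) {t : ℝ}
    (ht : 0 ≤ t) : serviceCDF lam rho beta t = 1 := by
  rw [serviceCDF_eq hlam hrho ht]
  simp [hbeta]

lemma tendsto_serviceCDF_atTop (hlam : 0 < lam) (hrho : 0 < rho) (hbeta₁ : -lam ≤ beta) :
    Tendsto (serviceCDF lam rho beta) atTop (𝓝 1) := by
  rcases hbeta₁.eq_or_lt with h | h
  · refine tendsto_const_nhds.congr' ?_
    filter_upwards [eventually_ge_atTop 0] with t ht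
    exact (serviceCDF_eq_one hlam hrho h.symm ht).symm
  · have ha : 0 < lam + beta := by linarith
    have := ((((tendsto_exp_neg_mul_atTop ha).const_mul (1 - Real.exp (-rho))).div
      (tendsto_idleProb_atTop (q := Real.exp (-rho)) ha) (Real.exp_pos _).ne').const_mul
        ((lam + beta) / lam)).const_sub 1
    simp only [mul_zero, zero_div, sub_zero] at this
    refine this.congr' ?_
    filter_upwards [eventually_ge_atTop 0] with t ht
    exact (serviceCDF_eq hlam hrho ht).symm

lemma exists_measure_serviceCDF (hlam : 0 < lam) (hrho : 0 < rho)
    (hbeta₁ : -lam ≤ beta) (hbeta₂ : beta ≤ lam / (Real.exp rho - 1)) :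
    ∃ ν : Measure ℝ, IsProbabilityMeasure ν ∧
      ∀ t : ℝ, ν.real (Iic t) = serviceCDF lam rho beta t := by
  have hmono := serviceCDF_monotone hlam hrho hbeta₁ hbeta₂
  let f : StieltjesFunction ℝ := ⟨serviceCDF lam rho beta, hmono,
    serviceCDF_continuousWithinAt hlam hrho⟩
  have hbot : Tendsto f atBot (𝓝 0) := by
    refine tendsto_const_nhds.congr' ?_
    filter_upwards [eventually_lt_atBot 0] with t ht
    exact (serviceCDF_of_neg ht).symm
  refine ⟨f.measure, f.isProbabilityMeasure hbot (tendsto_serviceCDF_atTop hlam hrho hbeta₁),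
    fun t => ?_⟩
  rw [measureReal_def, f.measure_Iic hbot, sub_zero]
  refine ENNReal.toReal_ofReal (le_of_eq_of_le ?_ (hmono (min_le_left t (-1))))
  exact (serviceCDF_of_neg (min_lt_of_right_lt neg_one_lt_zero)).symm

lemma integral_one_sub_serviceCDF (hlam : 0 < lam) (hrho : 0 < rho) (hbeta : -lam < beta) :
    IntegrableOn (fun v => 1 - serviceCDF lam rho beta v) (Ioi 0) ∧
      lam * ∫ v in Ioi (0 : ℝ), (1 - serviceCDF lam rho beta v) = rho := by
  have ha : 0 < lam + beta := by linarith
  have hq := Real.exp_pos (-rho)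
  have hq1 := exp_neg_lt_one hrho
  have hpos := fun t => idleProb_pos (a := lam + beta) hq hq1.le t
  set p := idleProb (Real.exp (-rho)) (lam + beta) with hp
  -- A primitive of 1 - G: it starts at 0 because p(0) = 1 and tends to rho/lam because p tends to
  -- exp(-rho).
  let g : ℝ → ℝ := fun t => -(lam⁻¹ * Real.log (p t))
  have hg : ∀ t ∈ Ioi (0 : ℝ), HasDerivAt g (1 - serviceCDF lam rho beta t) t := by
    intro t ht
    have := (((hasDerivAt_idleProb (Real.exp (-rho)) (lam + beta) t).log
      (hpos t).ne').const_mul lam⁻¹).neg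
    convert! this using 1
    rw [serviceCDF_eq hlam hrho (le_of_lt ht), ← hp]
    have := hpos t
    field_simp
    ring
  have hgc : ContinuousWithinAt g (Ici 0) 0 :=
    (continuous_const.mul ((continuous_idleProb _ _).log fun t => (hpos t).ne')).neg
      |>.continuousWithinAt
  have hnn : ∀ t ∈ Ioi (0 : ℝ), 0 ≤ 1 - serviceCDF lam rho beta t := by
    intro t ht
    rw [serviceCDF_eq hlam hrho (le_of_lt ht), sub_sub_cancel]
    have h1 : 0 ≤ 1 - Real.exp (-rho) := by linarith
    have := (hpos t).le
    positivity
  have hlim : Tendsto g atTop (𝓝 (lam⁻¹ * rho)) := by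
    have := (((tendsto_idleProb_atTop (q := Real.exp (-rho)) ha).log hq.ne').const_mul lam⁻¹).neg
    simpa using this
  refine ⟨integrableOn_Ioi_deriv_of_nonneg hgc hg hnn hlim, ?_⟩
  rw [integral_Ioi_of_hasDerivAt_of_nonneg hgc hg hnn hlim]
  simp [g, hp, idleProb, hlam.ne']

end ServiceCDF

/-! ### The function whose values along the arrivals form a martingale. -/

/-- The conditional probability that the busy period ends by time `t`, given that at time `x` the
last departure among the customers who have arrived so far is due at time `d`. -/
noncomputable def endProb (q a t d x : ℝ) : ℝ :=
  if d ≤ t then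
    1 - (1 - q) * Real.exp (-(q * a * (t - d))) * (1 - Real.exp (-(a * max (d - x) 0)))
  else 0

section EndProb

variable {q a t d x : ℝ}

lemma endProb_of_lt (h : t < d) : endProb q a t d x = 0 := if_neg (not_le.2 h)

lemma endProb_of_le (h : d ≤ t) (hx : d ≤ x) : endProb q a t d x = 1 := by
  rw [endProb, if_pos h, max_eq_right (by linarith)]
  simp

lemma endProb_of_ge (h : d ≤ t) (hx : x ≤ d) : endProb q a t d x =
    1 - (1 - q) * Real.exp (-(q * a * (t - d))) * (1 - Real.exp (-(a * (d - x)))) := by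
  rw [endProb, if_pos h, max_eq_left (by linarith)]

lemma endProb_mem_Icc (hq : 0 < q) (hq1 : q ≤ 1) (ha : 0 ≤ a) :
    endProb q a t d x ∈ Icc (0 : ℝ) 1 := by
  unfold endProb
  split_ifs with h
  · have h1 : Real.exp (-(q * a * (t - d))) ≤ 1 := by
      rw [Real.exp_le_one_iff, neg_nonpos]
      exact mul_nonneg (mul_nonneg hq.le ha) (sub_nonneg.2 h)
    have h2 : Real.exp (-(a * max (d - x) 0)) ≤ 1 := by
      rw [Real.exp_le_one_iff, neg_nonpos]
      exact mul_nonneg ha (le_max_right _ _)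
    have h3 := Real.exp_pos (-(q * a * (t - d)))
    have h4 := Real.exp_pos (-(a * max (d - x) 0))
    have h5 : (1 - q) * Real.exp (-(q * a * (t - d))) ≤ 1 :=
      mul_le_one₀ (by linarith) h3.le h1
    have h6 : 0 ≤ (1 - q) * Real.exp (-(q * a * (t - d))) := mul_nonneg (by linarith) h3.le
    have h7 : (1 - q) * Real.exp (-(q * a * (t - d))) * (1 - Real.exp (-(a * max (d - x) 0))) ≤ 1 :=
      mul_le_one₀ h5 (by linarith) (by linarith)
    have h8 := mul_nonneg h6 (sub_nonneg.2 h2)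
    constructor <;> linarith
  · simp

lemma norm_endProb_le_one (hq : 0 < q) (hq1 : q ≤ 1) (ha : 0 ≤ a) :
    ‖endProb q a t d x‖ ≤ 1 := by
  obtain ⟨h0, h1⟩ := endProb_mem_Icc (t := t) (d := d) (x := x) hq hq1 ha
  rwa [Real.norm_of_nonneg h0]

lemma measurable_endProb (q a t : ℝ) : Measurable fun z : ℝ × ℝ => endProb q a t z.1 z.2 := by
  unfold endProb
  exact Measurable.ite (measurableSet_le measurable_fst measurable_const) (by fun_prop)
    measurable_const

end EndProb

/-! ### Averaging over one arrival. -/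

section Arrival

variable {q a lam : ℝ}

/-- The function of which `endProb` is the value at `c = 1`, along the branch on which the busy
period is still going on. -/
noncomputable def branch (q a c t x z : ℝ) : ℝ :=
  1 - (1 - q) * Real.exp (-(q * a * (t - z))) * (1 - c * Real.exp (-(a * (z - x))))

lemma hasDerivAt_branch (q a c t x z : ℝ) : HasDerivAt (branch q a c t x)
    (-((1 - q) * a * Real.exp (-(q * a * (t - z))) *
      (q + (1 - q) * (c * Real.exp (-(a * (z - x))))))) z := by
  have h1 : HasDerivAt (fun z => Real.exp (-(q * a * (t - z))))
      (q * a * Real.exp (-(q * a * (t - z)))) z := by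
    convert! ((((hasDerivAt_id z).const_sub t).const_mul (q * a)).neg).exp using 1
    simp; ring
  have h2 : HasDerivAt (fun z => Real.exp (-(a * (z - x))))
      (-(a * Real.exp (-(a * (z - x))))) z := by
    convert! ((((hasDerivAt_id z).sub_const x).const_mul a).neg).exp using 1
    simp; ring
  convert! ((h1.const_mul (1 - q)).mul ((h2.const_mul c).const_sub 1)).const_sub 1 using 1
  ring

/-- Averaging `endProb` over the service length of a customer who arrives at time `x`. -/
lemma integral_endProb_max {σ : Measure ℝ}
    [IsProbabilityMeasure σ]
    (hσ : ∀ z, 0 ≤ z → σ.real (Iic z) * idleProb q a z =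
      idleProb q a z - a / lam * ((1 - q) * Real.exp (-(a * z))))
    {t d x : ℝ} (hx : x ≤ d) (hd : d ≤ t) :
    ∫ y, endProb q a t (max d (x + y)) x ∂σ = branch q a (1 - a / lam) t x d := by
  set f : ℝ → ℝ := fun z => -((1 - q) * a * Real.exp (-(q * a * (t - z))) *
      (q + (1 - q) * (1 * Real.exp (-(a * (z - x)))))) with hf
  have hfc : Continuous f := by fun_prop
  have hfi : ∀ u v, IntervalIntegrable f volume u v := fun u v => hfc.intervalIntegrable u v
  -- The value at due time max d (x + y) is the value at due time t minus the integral of the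
  -- derivative f between them. Now y occurs only in indicators, whose σ-integrals are values of the
  -- distribution function.
  have hpt : ∀ y, endProb q a t (max d (x + y)) x =
      (Iic (t - x)).indicator (fun _ => branch q a 1 t x t) y -
        ∫ z in Ioc d t, (Ici (x + y)).indicator f z := by
    intro y
    rw [setIntegral_indicator measurableSet_Ici]
    by_cases hy : y ≤ t - x
    · have hm : max d (x + y) ≤ t := max_le hd (by linarith)
      -- The closed half-line is needed so that the swap produces σ of `Iic`, as σ may have atoms;
      -- for Lebesgue measure the endpoint is negligible.
      have hset : (Ioc d t ∩ Ici (x + y) : Set ℝ) =ᵐ[volume] Ioc (max d (x + y)) t := by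
        have : (Ioc d t ∩ Ioi (x + y) : Set ℝ) = Ioc (max d (x + y)) t := by
          ext z; simp only [mem_inter_iff, mem_Ioc, mem_Ioi, max_lt_iff]; tauto
        rw [← this]
        exact (ae_eq_refl _).inter Ioi_ae_eq_Ici.symm
      rw [setIntegral_congr_set hset, ← intervalIntegral.integral_of_le hm,
        intervalIntegral.integral_eq_sub_of_hasDerivAt
          (fun z _ => hasDerivAt_branch q a 1 t x z) (hfi _ _),
        indicator_of_mem (by exact hy), sub_sub_cancel, endProb_of_ge hm (hx.trans (le_max_left _ _)),
        branch, one_mul]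
    · have hempty : (Ioc d t ∩ Ici (x + y) : Set ℝ) = ∅ := by
        ext z
        simp only [mem_inter_iff, mem_Ioc, mem_Ici, mem_empty_iff_false, iff_false]
        rintro ⟨⟨_, h1⟩, h2⟩
        linarith
      rw [hempty, indicator_of_notMem (by exact hy), setIntegral_empty, sub_zero,
        endProb_of_lt (lt_max_of_lt_right (by linarith))]
  have hint : Integrable (fun p : ℝ × ℝ => (Ici (x + p.1)).indicator f p.2)
      (σ.prod (volume.restrict (Ioc d t))) := by
    have h1 : Integrable (fun p : ℝ × ℝ => f p.2) (σ.prod (volume.restrict (Ioc d t))) :=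
      ((hfc.integrableOn_Ioc (a := d) (b := t)).integrable).comp_snd σ
    have hS : MeasurableSet {p : ℝ × ℝ | x + p.1 ≤ p.2} :=
      measurableSet_le (by fun_prop) measurable_snd
    refine (h1.indicator hS).congr (Eventually.of_forall fun p => ?_)
    simp only [indicator, mem_ofPred_eq, mem_Ici]
  have hswap := integral_integral_swap (f := fun y z => (Ici (x + y)).indicator f z) hint
  simp_rw [hpt]
  rw [integral_sub ((integrable_const _).indicator measurableSet_Iic) hint.integral_prod_left,
    hswap, integral_indicator_const _ measurableSet_Iic]
  -- The last factor of f z is the idle probability at z - x, so multiplying by G(z - x) turns f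
  -- into the derivative of `branch` with c = 1 - a/lam.
  have hinner : ∀ z ∈ Ioc d t, ∫ y, (Ici (x + y)).indicator f z ∂σ =
      -((1 - q) * a * Real.exp (-(q * a * (t - z))) *
        (q + (1 - q) * ((1 - a / lam) * Real.exp (-(a * (z - x)))))) := by
    intro z hz
    have h1 : (fun y => (Ici (x + y)).indicator f z) = (Iic (z - x)).indicator fun _ => f z := by
      ext y
      simp only [indicator, mem_Ici, mem_Iic, le_sub_iff_add_le']
    rw [h1, integral_indicator_const _ measurableSet_Iic, smul_eq_mul, hf]
    have := hσ (z - x) (by linarith [hz.1])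
    unfold idleProb at this
    linear_combination -((1 - q) * a * Real.exp (-(q * a * (t - z)))) * this
  rw [setIntegral_congr_fun measurableSet_Ioc hinner, ← intervalIntegral.integral_of_le hd,
    intervalIntegral.integral_eq_sub_of_hasDerivAt
      (fun z _ => hasDerivAt_branch q a (1 - a / lam) t x z)
      (Continuous.intervalIntegrable (by fun_prop) _ _)]
  -- At z = t the branch with c = 1 is itself the idle probability at t - x, so the same identity
  -- matches the boundary terms.
  have := hσ (t - x) (by linarith)
  unfold idleProb at this
  simp only [branch, smul_eq_mul, sub_self, mul_zero, neg_zero, Real.exp_zero]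
  linear_combination this

lemma integral_expMeasure (hlam : 0 < lam) (f : ℝ → ℝ) :
    ∫ s, f s ∂expMeasure lam = ∫ s in Ioi (0 : ℝ), lam * Real.exp (-(lam * s)) * f s := by
  have h : expMeasure lam = volume.withDensity (exponentialPDF lam) := rfl
  have hm : Measurable (exponentialPDF lam) :=
    (measurable_exponentialPDFReal lam).ennreal_ofReal
  rw [h, integral_withDensity_eq_integral_toReal_smul hm
      (Eventually.of_forall fun _ => ENNReal.ofReal_lt_top),
    ← integral_Ici_eq_integral_Ioi, ← integral_indicator measurableSet_Ici]
  refine integral_congr_ae (Eventually.of_forall fun s => ?_)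
  by_cases hs : 0 ≤ s
  · have hs' : s ∈ Ici (0 : ℝ) := hs
    simp only [indicator_of_mem hs', exponentialPDF_of_nonneg hs, smul_eq_mul]
    rw [ENNReal.toReal_ofReal (by positivity)]
  · have hs' : s ∉ Ici (0 : ℝ) := hs
    simp [indicator_of_notMem hs', exponentialPDF_of_neg (not_le.1 hs)]

lemma expMeasure_ae_pos (hlam : 0 < lam) : ∀ᵐ s ∂expMeasure lam, 0 < s := by
  have := isProbabilityMeasure_expMeasure hlam
  have h : (expMeasure lam).real (Iic 0) = 0 := by
    rw [← cdf_eq_real, cdf_expMeasure_eq hlam]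
    simp
  rw [measureReal_eq_zero_iff] at h
  refine measure_mono_null (fun s hs => ?_) h
  simpa using hs

lemma expMeasure_real_Ioi (hlam : 0 < lam) {x : ℝ} (hx : 0 ≤ x) :
    (expMeasure lam).real (Ioi x) = Real.exp (-(lam * x)) := by
  have := isProbabilityMeasure_expMeasure hlam
  rw [← compl_Iic, probReal_compl_eq_one_sub measurableSet_Iic, ← cdf_eq_real,
    cdf_expMeasure_eq hlam, if_pos hx]
  ring

/-- How the due time `d` of the last departure changes when a customer with service length `y`
arrives at time `u`; it is frozen once the busy period is over. -/
noncomputable def nextEnd (d u y : ℝ) : ℝ := if d < u then d else max d (u + y)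

lemma le_nextEnd (d u y : ℝ) : d ≤ nextEnd d u y := by
  unfold nextEnd
  split_ifs
  exacts [le_rfl, le_max_left _ _]

lemma measurable_nextEnd : Measurable fun z : ℝ × ℝ × ℝ => nextEnd z.1 z.2.1 z.2.2 := by
  unfold nextEnd
  exact Measurable.ite (measurableSet_lt (by fun_prop) (by fun_prop)) (by fun_prop) (by fun_prop)

/-- The one-step martingale identity for `endProb`. -/
lemma integral_endProb_nextEnd (hlam : 0 < lam)
    {σ : Measure ℝ} [IsProbabilityMeasure σ]
    (hσ : ∀ z, 0 ≤ z → σ.real (Iic z) * idleProb q a z =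
      idleProb q a z - a / lam * ((1 - q) * Real.exp (-(a * z))))
    (t d x : ℝ) :
    ∫ s, ∫ y, endProb q a t (nextEnd d (x + s) y) (x + s) ∂σ ∂expMeasure lam =
      endProb q a t d x := by
  have := isProbabilityMeasure_expMeasure hlam
  rcases lt_or_ge t d with hd | hd
  · simp [endProb_of_lt hd, endProb_of_lt (hd.trans_le (le_nextEnd _ _ _))]
  have hlate : ∀ s, d < x + s → ∫ y, endProb q a t (nextEnd d (x + s) y) (x + s) ∂σ = 1 := by
    intro s hs
    have : ∀ y, endProb q a t (nextEnd d (x + s) y) (x + s) = 1 := fun y => by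
      rw [nextEnd, if_pos hs, endProb_of_le hd hs.le]
    simp [this]
  rcases le_or_gt d x with hx | hx
  · have : ∀ᵐ s ∂expMeasure lam,
        ∫ y, endProb q a t (nextEnd d (x + s) y) (x + s) ∂σ = 1 := by
      filter_upwards [expMeasure_ae_pos hlam] with s hs
      exact hlate s (by linarith)
    rw [integral_congr_ae this, endProb_of_le hd hx]
    simp
  have hearly : ∀ s, x + s ≤ d → ∫ y, endProb q a t (nextEnd d (x + s) y) (x + s) ∂σ =
      branch q a (1 - a / lam) t (x + s) d := by
    intro s hs
    simp_rw [nextEnd, if_neg (not_lt.2 hs)]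
    exact integral_endProb_max hσ hs hd
  have h1 : EqOn (fun s => lam * Real.exp (-(lam * s)) *
      ∫ y, endProb q a t (nextEnd d (x + s) y) (x + s) ∂σ)
      (fun s => lam * Real.exp (-(lam * s)) * branch q a (1 - a / lam) t (x + s) d)
      (Ioc 0 (d - x)) := by
    intro s hs
    simp only [hearly s (by linarith [hs.2])]
  have h2 : EqOn (fun s => lam * Real.exp (-(lam * s)) *
      ∫ y, endProb q a t (nextEnd d (x + s) y) (x + s) ∂σ)
      (fun s => lam * Real.exp (-(lam * s)) * 1) (Ioi (d - x)) := by
    intro s hs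
    simp only [hlate s (by linarith [mem_Ioi.1 hs])]
  have hc : Continuous fun s =>
      lam * Real.exp (-(lam * s)) * branch q a (1 - a / lam) t (x + s) d := by
    unfold branch; fun_prop
  have hdx : 0 ≤ d - x := by linarith
  have htail : ∀ s ∈ Ioi (d - x), HasDerivAt (fun s => -Real.exp (-(lam * s)))
      (lam * Real.exp (-(lam * s)) * 1) s := by
    intro s _
    convert! (hasDerivAt_exp_neg_mul lam s).neg using 1
    ring
  have hlim : Tendsto (fun s => -Real.exp (-(lam * s))) atTop (𝓝 0) := by
    simpa using (tendsto_exp_neg_mul_atTop hlam).neg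
  have hcont : ContinuousWithinAt (fun s => -Real.exp (-(lam * s))) (Ici (d - x)) (d - x) :=
    (by fun_prop : Continuous fun s => -Real.exp (-(lam * s))).continuousWithinAt
  have hnn : ∀ s ∈ Ioi (d - x), 0 ≤ lam * Real.exp (-(lam * s)) * 1 := fun s _ => by positivity
  -- The primitive is -exp(-lam s) times the c = 1 branch seen from x + s. Differentiating the
  -- second factor supplies the missing -a/lam.
  have hprim : ∀ s, HasDerivAt (fun s => -Real.exp (-(lam * s)) *
      (1 - (1 - q) * Real.exp (-(q * a * (t - d))) * (1 - Real.exp (-(a * (d - (x + s)))))))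
      (lam * Real.exp (-(lam * s)) * branch q a (1 - a / lam) t (x + s) d) s := by
    intro s
    have h3 : HasDerivAt (fun s => Real.exp (-(a * (d - (x + s)))))
        (a * Real.exp (-(a * (d - (x + s))))) s := by
      convert! (((((hasDerivAt_id s).const_add x).const_sub d).const_mul a).neg).exp using 1
      simp; ring
    convert! (hasDerivAt_exp_neg_mul lam s).neg.mul
      (((h3.const_sub 1).const_mul ((1 - q) * Real.exp (-(q * a * (t - d))))).const_sub 1) using 1
    simp only [branch, Pi.neg_apply]
    field_simp
    ring
  rw [integral_expMeasure hlam, ← Ioc_union_Ioi_eq_Ioi hdx,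
    setIntegral_union (Ioc_disjoint_Ioi le_rfl) measurableSet_Ioi
      (hc.integrableOn_Ioc.congr_fun h1.symm measurableSet_Ioc)
      ((integrableOn_Ioi_deriv_of_nonneg hcont htail hnn hlim).congr_fun h2.symm
        measurableSet_Ioi),
    setIntegral_congr_fun measurableSet_Ioc h1, setIntegral_congr_fun measurableSet_Ioi h2,
    integral_Ioi_of_hasDerivAt_of_nonneg hcont htail hnn hlim,
    ← intervalIntegral.integral_of_le hdx,
    intervalIntegral.integral_eq_sub_of_hasDerivAt (fun s _ => hprim s) (hc.intervalIntegrable _ _),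
    endProb_of_ge hd hx.le]
  -- At s = d - x the primitive equals -exp(-lam (d - x)), which cancels the contribution of
  -- arrivals after d.
  have h4 : d - (x + (d - x)) = 0 := by ring
  simp only [h4, mul_zero, neg_zero, Real.exp_zero, add_zero]
  ring

end Arrival

/-! ### Sample paths: the busy period through successive due times. -/

section Paths

variable {Ω : Type*} {T S : ℕ → Ω → ℝ} {ω : Ω}

/-- The time at which the last of the customers `0, …, n` who belong to the first busy period
departs. -/
noncomputable def lastDeparture (T S : ℕ → Ω → ℝ) : ℕ → Ω → ℝ
  | 0, ω => S 0 ω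
  | n + 1, ω => nextEnd (lastDeparture T S n ω) (arrival T (n + 1) ω) (S (n + 1) ω)

@[simp] lemma arrival_zero (T : ℕ → Ω → ℝ) (ω : Ω) : arrival T 0 ω = 0 := by simp [arrival]

lemma arrival_succ (T : ℕ → Ω → ℝ) (n : ℕ) (ω : Ω) :
    arrival T (n + 1) ω = arrival T n ω + T n ω := by simp [arrival, Finset.sum_range_succ]

lemma monotone_arrival (hT : ∀ n, 0 ≤ T n ω) : Monotone fun n => arrival T n ω :=
  monotone_nat_of_le_succ fun n => by rw [arrival_succ]; linarith [hT n]

lemma monotone_lastDeparture (T S : ℕ → Ω → ℝ) (ω : Ω) :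
    Monotone fun n => lastDeparture T S n ω :=
  monotone_nat_of_le_succ fun _ => le_nextEnd _ _ _

lemma numInService_eq_zero_iff {t : ℝ} :
    numInService T S t ω = 0 ↔ ∀ n, arrival T n ω ≤ t → arrival T n ω + S n ω ≤ t := by
  simp [numInService, Set.encard_eq_zero, Set.eq_empty_iff_forall_notMem]

/-- A later customer of the first busy period arrives no later than the preceding due time, hence by
t, and so must have left by t. -/
lemma lastDeparture_le_of_numInService_eq_zero {t : ℝ} (ht : 0 ≤ t)
    (h : numInService T S t ω = 0) (n : ℕ) : lastDeparture T S n ω ≤ t := by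
  rw [numInService_eq_zero_iff] at h
  induction n with
  | zero => simpa [lastDeparture] using h 0 (by simpa using ht)
  | succ n ih =>
    rw [lastDeparture, nextEnd]
    split_ifs with hn
    · exact ih
    · exact max_le ih (h _ ((not_lt.1 hn).trans ih))

lemma busyPeriod_le_iff (hT : ∀ n, 0 ≤ T n ω) (hS : 0 ≤ S 0 ω)
    (hX : Tendsto (fun n => arrival T n ω) atTop atTop) (t : ℝ≥0) :
    busyPeriod T S ω ≤ t ↔ ∀ n, lastDeparture T S n ω ≤ t := by
  constructor
  · intro h n
    -- The infimum is not known to be attained, so an empty instant below t + ε is used.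
    refine le_of_forall_pos_lt_add fun ε hε => ?_
    have hlt : busyPeriod T S ω < ((t + ⟨ε, hε.le⟩ : ℝ≥0) : ℝ≥0∞) :=
      h.trans_lt (ENNReal.coe_lt_coe.2 (lt_add_of_pos_right t hε))
    simp only [busyPeriod, iInf_lt_iff] at hlt
    obtain ⟨u, hu, hut⟩ := hlt
    have hut' : (u : ℝ) < t + ε := NNReal.coe_lt_coe.2 (ENNReal.coe_lt_coe.1 hut)
    exact (lastDeparture_le_of_numInService_eq_zero u.2 hu n).trans_lt hut'
  · intro h
    -- Due times stay below t while arrivals diverge, so some arrival comes after the current due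
    -- time. At the first such gap the system is empty.
    have hex : ∃ n, lastDeparture T S n ω < arrival T (n + 1) ω := by
      obtain ⟨n, hn⟩ := ((tendsto_add_atTop_iff_nat 1).2 hX |>.eventually_gt_atTop (t : ℝ)).exists
      exact ⟨n, (h n).trans_lt hn⟩
    classical
    set N := Nat.find hex
    have hfin := Nat.find_spec hex
    have hmin : ∀ k < N, arrival T (k + 1) ω ≤ lastDeparture T S k ω := fun k hk =>
      not_lt.1 (Nat.find_min hex hk)
    have hdep : ∀ k ≤ N, arrival T k ω + S k ω ≤ lastDeparture T S k ω := by
      intro k hk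
      cases k with
      | zero => simp [lastDeparture]
      | succ k =>
        rw [lastDeparture, nextEnd, if_neg (not_lt.2 (hmin k hk))]
        exact le_max_right _ _
    have h0 : 0 ≤ lastDeparture T S N ω :=
      hS.trans (monotone_lastDeparture T S ω (Nat.zero_le N))
    have hidle : numInService T S (lastDeparture T S N ω) ω = 0 := by
      rw [numInService_eq_zero_iff]
      intro k hk
      rcases le_or_gt k N with hkN | hkN
      · exact (hdep k hkN).trans (monotone_lastDeparture T S ω hkN)
      · exact absurd (hk.trans_lt hfin) (not_lt.2 (monotone_arrival hT hkN))
    lift lastDeparture T S N ω to ℝ≥0 using h0 with u hu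
    refine (iInf₂_le u hidle).trans (ENNReal.coe_le_coe.2 (NNReal.coe_le_coe.1 ?_))
    rw [hu]
    exact h N

lemma busyPeriod_eq_iSup (hT : ∀ n, 0 ≤ T n ω) (hS : 0 ≤ S 0 ω)
    (hX : Tendsto (fun n => arrival T n ω) atTop atTop) :
    busyPeriod T S ω = ⨆ n, ENNReal.ofReal (lastDeparture T S n ω) := by
  refine ENNReal.eq_of_forall_le_nnreal_iff fun t => ?_
  simp only [busyPeriod_le_iff hT hS hX, iSup_le_iff, ENNReal.ofReal_le_coe]

lemma tendsto_endProb {q a : ℝ} (hX : Tendsto (fun n => arrival T n ω) atTop atTop) (t : ℝ) :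
    Tendsto (fun n => endProb q a t (lastDeparture T S n ω) (arrival T n ω)) atTop
      (𝓝 ({ω | ∀ n, lastDeparture T S n ω ≤ t}.indicator 1 ω)) := by
  by_cases h : ∀ n, lastDeparture T S n ω ≤ t
  · rw [indicator_of_mem (by exact h)]
    refine tendsto_const_nhds.congr' ?_
    filter_upwards [hX.eventually_ge_atTop t] with n hn
    exact (endProb_of_le (h n) ((h n).trans hn)).symm
  · rw [indicator_of_notMem (by exact h)]
    push Not at h
    obtain ⟨m, hm⟩ := h
    refine tendsto_const_nhds.congr' ?_
    filter_upwards [eventually_ge_atTop m] with n hn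
    exact (endProb_of_lt (hm.trans_le (monotone_lastDeparture T S ω hn))).symm

end Paths

/-! ### Information available after each arrival. -/

section History

variable {Ω : Type*} {T S : ℕ → Ω → ℝ}

/-- The information carried by the customers `0, …, n`. -/
@[reducible] def history (T S : ℕ → Ω → ℝ) (n : ℕ) : MeasurableSpace Ω :=
  ⨆ i ∈ {i : ℕ ⊕ ℕ | Sum.elim (· < n) (· ≤ n) i},
    MeasurableSpace.comap (Sum.elim T S i) inferInstance

lemma history_mono (T S : ℕ → Ω → ℝ) : Monotone (history T S) := by
  intro m n hmn
  refine biSup_mono ?_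
  rintro (i | i) hi
  · exact lt_of_lt_of_le (b := m) hi hmn
  · exact le_trans (b := m) hi hmn

lemma measurable_interarrival_history {k n : ℕ} (h : k < n) : Measurable[history T S n] (T k) := by
  refine Measurable.mono (comap_measurable (T k)) ?_ le_rfl
  exact le_iSup₂_of_le (f := fun i (_ : i ∈ {i : ℕ ⊕ ℕ | Sum.elim (· < n) (· ≤ n) i}) =>
    MeasurableSpace.comap (Sum.elim T S i) inferInstance) (Sum.inl k) h le_rfl

lemma measurable_service_history {k n : ℕ} (h : k ≤ n) : Measurable[history T S n] (S k) := by
  refine Measurable.mono (comap_measurable (S k)) ?_ le_rfl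
  exact le_iSup₂_of_le (f := fun i (_ : i ∈ {i : ℕ ⊕ ℕ | Sum.elim (· < n) (· ≤ n) i}) =>
    MeasurableSpace.comap (Sum.elim T S i) inferInstance) (Sum.inr k) h le_rfl

lemma measurable_arrival_history (n : ℕ) : Measurable[history T S n] (arrival T n) :=
  Finset.measurable_fun_sum _ fun _ hk =>
    measurable_interarrival_history (Finset.mem_range.1 hk)

lemma Measurable.nextEnd {m : MeasurableSpace Ω} {d u y : Ω → ℝ} (hd : Measurable d)
    (hu : Measurable u) (hy : Measurable y) :
    Measurable fun ω => nextEnd (d ω) (u ω) (y ω) :=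
  measurable_nextEnd.comp (hd.prodMk (hu.prodMk hy))

lemma measurable_lastDeparture_history (n : ℕ) :
    Measurable[history T S n] (lastDeparture T S n) := by
  induction n with
  | zero =>
    have h : Measurable[history T S 0] (S 0) := measurable_service_history (Nat.le_refl 0)
    exact h
  | succ n ih =>
    have ih' : Measurable[history T S (n + 1)] (lastDeparture T S n) :=
      ih.mono (history_mono T S n.le_succ) le_rfl
    have hX : Measurable[history T S (n + 1)] (arrival T (n + 1)) :=
      measurable_arrival_history (n + 1)
    have hS : Measurable[history T S (n + 1)] (S (n + 1)) :=
      measurable_service_history (Nat.le_refl _)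
    exact Measurable.nextEnd ih' hX hS

end History

lemma tendsto_arrival_of_frequently {Ω : Type*} {T : ℕ → Ω → ℝ} {ω : Ω}
    (hT : ∀ n, 0 ≤ T n ω) (h : ∃ᶠ n in atTop, 1 < T n ω) :
    Tendsto (fun n => arrival T n ω) atTop atTop := by
  refine tendsto_atTop_atTop_of_monotone (monotone_arrival hT) fun b => ?_
  have key : ∀ k : ℕ, ∃ n, (k : ℝ) ≤ arrival T n ω := by
    intro k
    induction k with
    | zero => exact ⟨0, by simp⟩
    | succ k ih =>
      obtain ⟨n, hn⟩ := ih
      obtain ⟨m, hnm, hm⟩ := (frequently_atTop.1 h) n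
      have hmono : arrival T n ω ≤ arrival T m ω := monotone_arrival hT hnm
      refine ⟨m + 1, ?_⟩
      rw [arrival_succ]
      push_cast
      linarith
  obtain ⟨k, hk⟩ := exists_nat_ge b
  obtain ⟨n, hn⟩ := key k
  exact ⟨n, hk.trans hn⟩

/-! ### The random queue: diverging arrivals, independence, constant expectation. -/

namespace IsQueue

variable {Ω : Type*} [MeasurableSpace Ω] {P : Measure Ω}
  {lam : ℝ} {G : ℝ → ℝ} {T S : ℕ → Ω → ℝ}

lemma measurable_sum_elim (hQ : IsQueue P lam G T S) (i : ℕ ⊕ ℕ) :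
    Measurable (Sum.elim T S i) := by
  cases i
  exacts [hQ.measurable_interarrival _, hQ.measurable_service _]

lemma history_le (hQ : IsQueue P lam G T S) (n : ℕ) : history T S n ≤ ‹MeasurableSpace Ω› :=
  iSup₂_le fun i _ => (hQ.measurable_sum_elim i).comap_le

lemma measurable_arrival (hQ : IsQueue P lam G T S) (n : ℕ) : Measurable (arrival T n) :=
  (measurable_arrival_history (S := S) n).mono (hQ.history_le n) le_rfl

lemma measurable_lastDeparture (hQ : IsQueue P lam G T S) (n : ℕ) :
    Measurable (lastDeparture T S n) :=
  (measurable_lastDeparture_history n).mono (hQ.history_le n) le_rfl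

lemma ae_interarrival_pos (hQ : IsQueue P lam G T S) (hlam : 0 < lam) :
    ∀ᵐ ω ∂P, ∀ n, 0 < T n ω := by
  refine ae_all_iff.2 fun n => ?_
  have h := expMeasure_ae_pos hlam
  rw [← hQ.interarrival_law n] at h
  exact ae_of_ae_map (hQ.measurable_interarrival n).aemeasurable h

variable [IsProbabilityMeasure P]

lemma ae_service_nonneg (hQ : IsQueue P lam G T S) (hG : ∀ t < 0, G t = 0) (n : ℕ) :
    ∀ᵐ ω ∂P, 0 ≤ S n ω := by
  -- G may have an atom at 0, so the negative half-line is exhausted by countably many levels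
  -- strictly below 0.
  have h : ∀ᵐ ω ∂P, ∀ k : ℕ, ¬ S n ω ≤ -(1 / ((k : ℝ) + 1)) := by
    refine ae_all_iff.2 fun k => ?_
    have h0 := (hQ.service_law n (-(1 / ((k : ℝ) + 1)))).trans
      (hG _ (neg_lt_zero.2 Nat.one_div_pos_of_nat))
    rw [measureReal_eq_zero_iff] at h0
    exact measure_eq_zero_iff_ae_notMem.1 h0
  filter_upwards [h] with ω hω
  by_contra! hneg
  obtain ⟨k, hk⟩ := exists_nat_one_div_lt (neg_pos.2 hneg)
  exact hω k (by linarith)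

/-- By the second Borel–Cantelli lemma infinitely many interarrival times exceed 1. -/
lemma ae_tendsto_arrival (hQ : IsQueue P lam G T S) (hlam : 0 < lam) :
    ∀ᵐ ω ∂P, Tendsto (fun n => arrival T n ω) atTop atTop := by
  have hms : ∀ n, MeasurableSet (T n ⁻¹' Ioi 1) := fun n =>
    hQ.measurable_interarrival n measurableSet_Ioi
  have hind : iIndepFun T P := hQ.indep.precomp (g := Sum.inl) Sum.inl_injective
  have hset : iIndepSet (fun n => T n ⁻¹' Ioi 1) P := by
    rw [iIndepSet_iff_meas_biInter hms]
    intro s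
    exact hind.measure_inter_preimage_eq_mul s fun _ _ => measurableSet_Ioi
  have hprob : ∀ n, P (T n ⁻¹' Ioi 1) = ENNReal.ofReal (Real.exp (-(lam * 1))) := by
    have := isProbabilityMeasure_expMeasure hlam
    intro n
    rw [← Measure.map_apply (hQ.measurable_interarrival n) measurableSet_Ioi,
      hQ.interarrival_law, ← expMeasure_real_Ioi hlam zero_le_one, ofReal_measureReal]
  have hsum : ∑' n, P (T n ⁻¹' Ioi 1) = ∞ := by
    simp_rw [hprob]
    exact ENNReal.tsum_const_eq_top_of_ne_zero (by simp [Real.exp_pos])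
  have hlimsup := measure_limsup_eq_one hms hset hsum
  have hae : ∀ᵐ ω ∂P, ω ∈ limsup (fun n => T n ⁻¹' Ioi 1) atTop :=
    (mem_ae_iff_prob_eq_one (MeasurableSet.measurableSet_limsup hms)).2 hlimsup
  filter_upwards [hae, hQ.ae_interarrival_pos hlam] with ω hω hT
  exact tendsto_arrival_of_frequently (fun n => (hT n).le) (mem_limsup_iff_frequently_mem.1 hω)

/-- The state after customer n involves `T k` for k < n and `S k` for k ≤ n only, so `T n` and `S (n
+ 1)` are fresh. -/
lemma map_prod_eq (hQ : IsQueue P lam G T S) {σ : Measure ℝ} (hσ : ∀ n, P.map (S n) = σ) (n : ℕ) :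
    P.map (fun ω => ((lastDeparture T S n ω, arrival T n ω), (T n ω, S (n + 1) ω))) =
      (P.map fun ω => (lastDeparture T S n ω, arrival T n ω)).prod ((expMeasure lam).prod σ) := by
  have hD := hQ.measurable_lastDeparture n
  have hX := hQ.measurable_arrival n
  have hTn := hQ.measurable_interarrival n
  have hSn := hQ.measurable_service (n + 1)
  have hTS : IndepFun (T n) (S (n + 1)) P :=
    hQ.indep.indepFun (i := Sum.inl n) (j := Sum.inr (n + 1)) Sum.inl_ne_inr
  have hmap : P.map (fun ω => (T n ω, S (n + 1) ω)) = (expMeasure lam).prod σ := by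
    rw [(indepFun_iff_map_prod_eq_prod_map_map hTn.aemeasurable hSn.aemeasurable).1 hTS,
      hQ.interarrival_law, hσ]
  have hdisj : Disjoint {i : ℕ ⊕ ℕ | Sum.elim (· < n) (· ≤ n) i}
      {Sum.inl n, Sum.inr (n + 1)} := by
    rw [Set.disjoint_right]
    rintro i (rfl | rfl) hi
    · exact absurd (show n < n from hi) (lt_irrefl n)
    · exact absurd (show n + 1 ≤ n from hi) (Nat.not_succ_le_self n)
  have hindep := indep_iSup_of_disjoint (fun i => (hQ.measurable_sum_elim i).comap_le)
    hQ.indep.iIndep hdisj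
  have hpast : Measurable[history T S n] fun ω => (lastDeparture T S n ω, arrival T n ω) :=
    (measurable_lastDeparture_history n).prodMk (measurable_arrival_history n)
  have hfut : Measurable[⨆ i ∈ ({Sum.inl n, Sum.inr (n + 1)} : Set (ℕ ⊕ ℕ)),
      MeasurableSpace.comap (Sum.elim T S i) inferInstance] fun ω => (T n ω, S (n + 1) ω) := by
    rw [iSup_pair]
    exact ((comap_measurable (T n)).mono le_sup_left le_rfl).prodMk
      ((comap_measurable (S (n + 1))).mono le_sup_right le_rfl)
  have hind : IndepFun (fun ω => (lastDeparture T S n ω, arrival T n ω))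
      (fun ω => (T n ω, S (n + 1) ω)) P :=
    (IndepFun_iff_Indep _ _ _).2 (indep_of_indep_of_le_left
      (indep_of_indep_of_le_right hindep hfut.comap_le) hpast.comap_le)
  rw [(indepFun_iff_map_prod_eq_prod_map_map (hD.prodMk hX).aemeasurable
    (hTn.prodMk hSn).aemeasurable).1 hind, hmap]

variable {q a : ℝ} {σ : Measure ℝ}

lemma integral_endProb_succ (hQ : IsQueue P lam G T S) (hlam : 0 < lam) (hq : 0 < q)
    (hq1 : q ≤ 1) (ha : 0 ≤ a) [IsProbabilityMeasure σ] (hσ : ∀ n, P.map (S n) = σ)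
    (hσG : ∀ z, 0 ≤ z → σ.real (Iic z) * idleProb q a z =
      idleProb q a z - a / lam * ((1 - q) * Real.exp (-(a * z)))) (t : ℝ) (n : ℕ) :
    ∫ ω, endProb q a t (lastDeparture T S (n + 1) ω) (arrival T (n + 1) ω) ∂P =
      ∫ ω, endProb q a t (lastDeparture T S n ω) (arrival T n ω) ∂P := by
  have := isProbabilityMeasure_expMeasure hlam
  have hh : Measurable fun ω => (lastDeparture T S n ω, arrival T n ω) :=
    (hQ.measurable_lastDeparture n).prodMk (hQ.measurable_arrival n)
  have := Measure.isProbabilityMeasure_map (μ := P) hh.aemeasurable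
  let F : (ℝ × ℝ) × (ℝ × ℝ) → ℝ := fun z =>
    endProb q a t (nextEnd z.1.1 (z.1.2 + z.2.1) z.2.2) (z.1.2 + z.2.1)
  have hF : Measurable F := by
    have h1 : Measurable fun z : (ℝ × ℝ) × (ℝ × ℝ) =>
        nextEnd z.1.1 (z.1.2 + z.2.1) z.2.2 :=
      Measurable.nextEnd (by fun_prop) (by fun_prop) (by fun_prop)
    exact (measurable_endProb q a t).comp (h1.prodMk (by fun_prop))
  have hbd : ∀ z, ‖F z‖ ≤ 1 := fun z => norm_endProb_le_one hq hq1 ha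
  calc ∫ ω, endProb q a t (lastDeparture T S (n + 1) ω) (arrival T (n + 1) ω) ∂P
      = ∫ ω, F ((lastDeparture T S n ω, arrival T n ω), (T n ω, S (n + 1) ω)) ∂P := by
        refine integral_congr_ae (Eventually.of_forall fun ω => ?_)
        simp only [lastDeparture, arrival_succ, F]
    _ = ∫ z, F z ∂(P.map fun ω => (lastDeparture T S n ω, arrival T n ω)).prod
          ((expMeasure lam).prod σ) := by
        rw [← hQ.map_prod_eq hσ n, integral_map _ hF.aestronglyMeasurable]
        exact (hh.prodMk ((hQ.measurable_interarrival n).prodMk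
          (hQ.measurable_service (n + 1)))).aemeasurable
    _ = ∫ h, endProb q a t h.1 h.2 ∂(P.map fun ω => (lastDeparture T S n ω, arrival T n ω)) := by
        rw [integral_prod _ (Integrable.of_bound hF.aestronglyMeasurable 1
          (Eventually.of_forall hbd))]
        refine integral_congr_ae (Eventually.of_forall fun h => ?_)
        have hFh : Measurable fun y => F (h, y) := hF.comp measurable_prodMk_left
        simp only
        rw [integral_prod _ (Integrable.of_bound hFh.aestronglyMeasurable 1
          (Eventually.of_forall fun y => hbd (h, y)))]
        exact integral_endProb_nextEnd hlam hσG t h.1 h.2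
    _ = _ := integral_map hh.aemeasurable (measurable_endProb q a t).aestronglyMeasurable

/-- The distribution function of the last departure of the busy period. -/
lemma measureReal_lastDeparture_le (hQ : IsQueue P lam G T S) (hlam : 0 < lam) (hq : 0 < q)
    (hq1 : q ≤ 1) (ha : 0 ≤ a) [IsProbabilityMeasure σ] (hσ : ∀ n, P.map (S n) = σ)
    (hσG : ∀ z, 0 ≤ z → σ.real (Iic z) * idleProb q a z =
      idleProb q a z - a / lam * ((1 - q) * Real.exp (-(a * z))))
    (hG : ∀ t < 0, G t = 0) {t : ℝ} (ht : 0 ≤ t) :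
    P.real {ω | ∀ n, lastDeparture T S n ω ≤ t} =
      1 - a / lam * (1 - q) * Real.exp (-(q * a * t)) := by
  have hmeas : MeasurableSet {ω | ∀ n, lastDeparture T S n ω ≤ t} := by
    rw [ofPred_forall]
    exact MeasurableSet.iInter fun n =>
      measurableSet_le (hQ.measurable_lastDeparture n) measurable_const
  have hlim : Tendsto
      (fun n => ∫ ω, endProb q a t (lastDeparture T S n ω) (arrival T n ω) ∂P) atTop
      (𝓝 (∫ ω, {ω | ∀ n, lastDeparture T S n ω ≤ t}.indicator 1 ω ∂P)) := by
    refine tendsto_integral_of_dominated_convergence (fun _ => 1) (fun n => ?_)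
      (integrable_const 1)
      (fun n => Eventually.of_forall fun ω => norm_endProb_le_one hq hq1 ha) ?_
    · exact ((measurable_endProb q a t).comp ((hQ.measurable_lastDeparture n).prodMk
        (hQ.measurable_arrival n))).aestronglyMeasurable
    · filter_upwards [hQ.ae_tendsto_arrival hlam] with ω hω
      exact tendsto_endProb hω t
  -- Customer 0 enters an empty system at time 0, so the base case is the service average with d = x
  -- = 0.
  have hconst : ∀ n, ∫ ω, endProb q a t (lastDeparture T S n ω) (arrival T n ω) ∂P =
      branch q a (1 - a / lam) t 0 0 := by
    intro n
    induction n with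
    | zero =>
      rw [← integral_endProb_max hσG le_rfl ht, ← hσ 0,
        integral_map (hQ.measurable_service 0).aemeasurable]
      · refine integral_congr_ae ?_
        filter_upwards [hQ.ae_service_nonneg hG 0] with ω hω
        simp [lastDeparture, hω]
      · exact ((measurable_endProb q a t).comp
          ((by fun_prop : Measurable fun y : ℝ => max 0 (0 + y)).prodMk
            measurable_const)).aestronglyMeasurable
    | succ n ih => rw [hQ.integral_endProb_succ hlam hq hq1 ha hσ hσG, ih]
  simp_rw [hconst] at hlim
  rw [← integral_indicator_one hmeas, tendsto_nhds_unique hlim tendsto_const_nhds, branch]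
  simp
  ring

end IsQueue

/-! ### From the distribution function to the law of the busy period. -/

/-- A nonnegative random variable with exponential tail `p * exp (-(r * t))` is a mixture of the
point mass at the origin and an exponential law. -/
lemma hasLaw_mixture {Ω : Type*} [MeasurableSpace Ω] {P : Measure Ω} [IsProbabilityMeasure P]
    {X : Ω → ℝ} (hX : AEMeasurable X P) (hX0 : ∀ ω, 0 ≤ X ω) {p r : ℝ} (hp : 0 ≤ p) (hp1 : p ≤ 1)
    (hr : 0 < r) (h : ∀ t, 0 ≤ t → P.real {ω | X ω ≤ t} = 1 - p * Real.exp (-(r * t))) :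
    HasLaw X (ENNReal.ofReal (1 - p) • Measure.dirac 0 + ENNReal.ofReal p • expMeasure r) P := by
  have := isProbabilityMeasure_expMeasure hr
  have := Measure.isProbabilityMeasure_map hX
  refine ⟨hX, Measure.ext_of_Iic _ _ fun t => ?_⟩
  have hfin : (ENNReal.ofReal (1 - p) • Measure.dirac 0 + ENNReal.ofReal p • expMeasure r :
      Measure ℝ) (Iic t) ≠ ∞ := by
    simp only [Measure.add_apply, Measure.smul_apply, smul_eq_mul]
    exact ENNReal.add_ne_top.2 ⟨ENNReal.mul_ne_top ENNReal.ofReal_ne_top (measure_ne_top _ _),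
      ENNReal.mul_ne_top ENNReal.ofReal_ne_top (measure_ne_top _ _)⟩
  rw [← ENNReal.toReal_eq_toReal_iff' (measure_ne_top _ _) hfin,
    Measure.map_apply_of_aemeasurable hX measurableSet_Iic]
  simp only [Measure.add_apply, Measure.smul_apply, smul_eq_mul]
  rw [ENNReal.toReal_add (ENNReal.mul_ne_top ENNReal.ofReal_ne_top (measure_ne_top _ _))
      (ENNReal.mul_ne_top ENNReal.ofReal_ne_top (measure_ne_top _ _)), ENNReal.toReal_mul,
    ENNReal.toReal_mul, ENNReal.toReal_ofReal (by linarith), ENNReal.toReal_ofReal hp,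
    ← measureReal_def (expMeasure r), ← cdf_eq_real, cdf_expMeasure_eq hr]
  rcases lt_or_ge t 0 with ht | ht
  · have : X ⁻¹' Iic t = ∅ := by
      ext ω
      simpa using ht.trans_le (hX0 ω)
    simp [this, not_le.2 ht]
  · have := h t ht
    rw [measureReal_def] at this
    change (P {ω | X ω ≤ t}).toReal = _
    rw [this, if_pos ht, Measure.dirac_apply' _ measurableSet_Iic, indicator_of_mem (by exact ht)]
    simp
    ring

namespace IsQueue

variable {Ω : Type*} [MeasurableSpace Ω] {P : Measure Ω} {lam rho beta : ℝ} {T S : ℕ → Ω → ℝ}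

section

variable {G : ℝ → ℝ} [IsProbabilityMeasure P]

lemma busyPeriod_ae_eq (hQ : IsQueue P lam G T S) (hlam : 0 < lam) (hG : ∀ t < 0, G t = 0) :
    busyPeriod T S =ᵐ[P] fun ω => ⨆ n, ENNReal.ofReal (lastDeparture T S n ω) := by
  filter_upwards [hQ.ae_interarrival_pos hlam, hQ.ae_service_nonneg hG 0,
    hQ.ae_tendsto_arrival hlam] with ω hT hS hX
  exact busyPeriod_eq_iSup (fun n => (hT n).le) hS hX

/-- `busyPeriod` is an infimum over uncountably many times; its almost sure form as a countable
supremum gives measurability. -/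
lemma aemeasurable_busyPeriod (hQ : IsQueue P lam G T S) (hlam : 0 < lam)
    (hG : ∀ t < 0, G t = 0) : AEMeasurable (busyPeriod T S) P :=
  ⟨_, Measurable.iSup fun n => (hQ.measurable_lastDeparture n).ennreal_ofReal,
    hQ.busyPeriod_ae_eq hlam hG⟩

end

variable [IsProbabilityMeasure P]

/-- The distribution function of the busy period. -/
lemma measureReal_busyPeriod_le (hQ : IsQueue P lam (serviceCDF lam rho beta) T S)
    (hlam : 0 < lam) (hrho : 0 < rho) (hbeta : -lam ≤ beta) (t : ℝ≥0) :
    P.real {ω | busyPeriod T S ω ≤ t} = 1 - (lam + beta) / lam * (1 - Real.exp (-rho)) *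
      Real.exp (-(Real.exp (-rho) * (lam + beta) * t)) := by
  have hG : ∀ t < 0, serviceCDF lam rho beta t = 0 := fun t ht => serviceCDF_of_neg ht
  have hprob : ∀ n, IsProbabilityMeasure (P.map (S n)) := fun n =>
    Measure.isProbabilityMeasure_map (hQ.measurable_service n).aemeasurable
  have hcdf : ∀ n z, (P.map (S n)).real (Iic z) = serviceCDF lam rho beta z := by
    intro n z
    rw [map_measureReal_apply (hQ.measurable_service n) measurableSet_Iic]
    exact hQ.service_law n z
  have hσ : ∀ n, P.map (S n) = P.map (S 0) := fun n =>
    Measure.ext_of_Iic _ _ fun z => by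
      rw [← measureReal_eq_measureReal_iff, hcdf, hcdf]
  have hlast := hQ.measureReal_lastDeparture_le hlam (Real.exp_pos (-rho))
    (exp_neg_lt_one hrho).le (a := lam + beta) (by linarith) hσ
    (fun z hz => by rw [hcdf, serviceCDF_mul_idleProb hlam hrho hz]) hG t.coe_nonneg
  rw [← hlast]
  refine measureReal_congr ?_
  filter_upwards [hQ.ae_interarrival_pos hlam, hQ.ae_service_nonneg hG 0,
    hQ.ae_tendsto_arrival hlam] with ω hT hS hX
  exact propext (busyPeriod_le_iff (fun n => (hT n).le) hS hX t)

lemma ae_busyPeriod_ne_top (hQ : IsQueue P lam (serviceCDF lam rho beta) T S)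
    (hlam : 0 < lam) (hrho : 0 < rho) (hbeta : -lam ≤ beta) :
    ∀ᵐ ω ∂P, busyPeriod T S ω ≠ ∞ := by
  have hle : ∀ n : ℕ, P.real {ω | busyPeriod T S ω ≤ ((n : ℝ≥0) : ℝ≥0∞)} ≤
      P.real {ω | busyPeriod T S ω ≠ ∞} := fun n =>
    measureReal_mono fun ω hω => ne_top_of_le_ne_top ENNReal.coe_ne_top hω
  have hlim : Tendsto (fun n : ℕ => P.real {ω | busyPeriod T S ω ≤ ((n : ℝ≥0) : ℝ≥0∞)}) atTop
      (𝓝 1) := by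
    simp_rw [hQ.measureReal_busyPeriod_le hlam hrho hbeta]
    -- For `beta = -lam` the exponential does not decay, but its coefficient vanishes.
    rcases hbeta.eq_or_lt with h | h
    · simp [← h]
    · have hr : 0 < Real.exp (-rho) * (lam + beta) :=
        mul_pos (Real.exp_pos _) (by linarith)
      have := (((tendsto_exp_neg_mul_atTop hr).comp tendsto_natCast_atTop_atTop).const_mul
        ((lam + beta) / lam * (1 - Real.exp (-rho)))).const_sub 1
      simpa [Function.comp_def] using this
  have hone : P.real {ω | busyPeriod T S ω ≠ ∞} = 1 :=
    le_antisymm measureReal_le_one (le_of_tendsto' hlim hle)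
  have hnull : NullMeasurableSet {ω | busyPeriod T S ω ≠ ∞} P :=
    ((hQ.aemeasurable_busyPeriod hlam fun t ht => serviceCDF_of_neg ht).nullMeasurableSet_preimage
      (measurableSet_singleton ∞)).compl
  refine (prob_compl_eq_zero_iff₀ hnull).2 ?_
  rwa [measureReal_def, ENNReal.toReal_eq_one_iff] at hone

lemma measureReal_toReal_busyPeriod_le (hQ : IsQueue P lam (serviceCDF lam rho beta) T S)
    (hlam : 0 < lam) (hrho : 0 < rho) (hbeta : -lam ≤ beta) {t : ℝ} (ht : 0 ≤ t) :
    P.real {ω | (busyPeriod T S ω).toReal ≤ t} =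
      1 - (lam + beta) / lam * (1 - Real.exp (-rho)) *
        Real.exp (-(Real.exp (-rho) * (lam + beta) * t)) := by
  lift t to ℝ≥0 using ht
  rw [← hQ.measureReal_busyPeriod_le hlam hrho hbeta t]
  refine measureReal_congr ?_
  -- `toReal` sends ∞ to 0, so the two events agree only where the busy period is finite.
  filter_upwards [hQ.ae_busyPeriod_ne_top hlam hrho hbeta] with ω hω
  refine propext ?_
  change (busyPeriod T S ω).toReal ≤ t ↔ busyPeriod T S ω ≤ t
  rw [← ENNReal.coe_toReal, ENNReal.toReal_le_toReal hω ENNReal.coe_ne_top]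

lemma hasLaw_busyPeriod (hQ : IsQueue P lam (serviceCDF lam rho beta) T S)
    (hlam : 0 < lam) (hrho : 0 < rho) (hbeta₁ : -lam < beta)
    (hbeta₂ : beta ≤ lam / (Real.exp rho - 1)) {p : ℝ}
    (hp : p = (lam + beta) / lam * (1 - Real.exp (-rho))) :
    HasLaw (fun ω => (busyPeriod T S ω).toReal)
      (ENNReal.ofReal (1 - p) • Measure.dirac 0 +
        ENNReal.ofReal p • expMeasure (Real.exp (-rho) * (lam + beta))) P := by
  have hq1 := exp_neg_lt_one hrho
  have ha : 0 < lam + beta := by linarith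
  refine hasLaw_mixture
    (hQ.aemeasurable_busyPeriod hlam fun t ht => serviceCDF_of_neg ht).ennreal_toReal
    (fun _ => ENNReal.toReal_nonneg) ?_ ?_ (mul_pos (Real.exp_pos _) ha) fun t ht => ?_
  · rw [hp]
    exact mul_nonneg (by positivity) (by linarith)
  · rw [hp]
    exact le_of_le_div_exp_sub_one hlam hrho hbeta₂
  · rw [hp]
    exact hQ.measureReal_toReal_busyPeriod_le hlam hrho hbeta₁.le ht

/-- At the largest admissible `beta` the exponential weight is 1, so the atom disappears. -/
lemma hasLaw_busyPeriod_exp (hQ : IsQueue P lam (serviceCDF lam rho beta) T S)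
    (hlam : 0 < lam) (hrho : 0 < rho) (hbeta : beta = lam / (Real.exp rho - 1)) :
    HasLaw (fun ω => (busyPeriod T S ω).toReal) (expMeasure (lam / (Real.exp rho - 1))) P := by
  have h1 : 0 < Real.exp rho - 1 := by linarith [Real.add_one_lt_exp hrho.ne']
  have hpos : 0 < lam / (Real.exp rho - 1) := by positivity
  have hp : 1 = (lam + beta) / lam * (1 - Real.exp (-rho)) := by
    rw [hbeta, Real.exp_neg]
    field_simp
    ring
  have hr : Real.exp (-rho) * (lam + beta) = lam / (Real.exp rho - 1) := by
    rw [hbeta, Real.exp_neg]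
    field_simp
    ring
  have := hQ.hasLaw_busyPeriod hlam hrho (by linarith) hbeta.le hp
  rwa [hr, sub_self, ENNReal.ofReal_zero, zero_smul, zero_add, ENNReal.ofReal_one, one_smul]
    at this

lemma hasLaw_busyPeriod_dirac (hQ : IsQueue P lam (serviceCDF lam rho beta) T S)
    (hlam : 0 < lam) (hrho : 0 < rho) (hbeta : beta = -lam) :
    HasLaw (fun ω => (busyPeriod T S ω).toReal) (Measure.dirac 0) P := by
  have hm := (hQ.aemeasurable_busyPeriod hlam fun t ht => serviceCDF_of_neg ht).ennreal_toReal
  have hone := hQ.measureReal_toReal_busyPeriod_le hlam hrho hbeta.ge le_rfl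
  rw [hbeta, add_neg_cancel, zero_div, zero_mul, zero_mul, sub_zero, measureReal_def,
    ENNReal.toReal_eq_one_iff] at hone
  have hae : ∀ᵐ ω ∂P, (busyPeriod T S ω).toReal ≤ 0 :=
    (prob_compl_eq_zero_iff₀ (hm.nullMeasurableSet_preimage measurableSet_Iic)).2 hone
  have hzero : (fun ω => (busyPeriod T S ω).toReal) =ᵐ[P] fun _ => (0 : ℝ) := by
    filter_upwards [hae] with ω hω
    exact le_antisymm hω ENNReal.toReal_nonneg
  refine ⟨hm, ?_⟩
  rw [Measure.map_congr hzero, Measure.map_const, measure_univ, one_smul]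

end IsQueue

end MGInfty

theorem mainTheorem1 (lam rho beta : ℝ) (hlam : 0 < lam) (hrho : 0 < rho)
    (hbeta₁ : -lam ≤ beta) (hbeta₂ : beta ≤ lam / (Real.exp rho - 1)) :
    -- the formula defines a probability distribution function
    (∃ ν : Measure ℝ, IsProbabilityMeasure ν ∧
      ∀ t : ℝ, ν.real (Iic t) = MGInfty.serviceCDF lam rho beta t) ∧
    -- it solves the Riccati equation with constant coefficient `beta`
    (∀ t : ℝ, 0 < t →
      HasDerivAt (MGInfty.serviceCDF lam rho beta)
        (-lam * MGInfty.serviceCDF lam rho beta t ^ 2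
          - (beta - lam) * MGInfty.serviceCDF lam rho beta t + beta) t) ∧
    -- `rho` is the traffic intensity, unless the service length is degenerate at the origin
    (-lam < beta →
      IntegrableOn (fun v => 1 - MGInfty.serviceCDF lam rho beta v) (Ioi 0) ∧
      lam * ∫ v in Ioi (0 : ℝ), (1 - MGInfty.serviceCDF lam rho beta v) = rho) ∧
    (beta = -lam → ∀ t : ℝ, 0 ≤ t → MGInfty.serviceCDF lam rho beta t = 1) ∧
    -- the busy period
    ∀ {Ω : Type*} [MeasurableSpace Ω] (P : Measure Ω) [IsProbabilityMeasure P]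
      (T S : ℕ → Ω → ℝ),
      MGInfty.IsQueue P lam (MGInfty.serviceCDF lam rho beta) T S →
      (∀ᵐ ω ∂P, MGInfty.busyPeriod T S ω ≠ ∞) ∧
      (∀ t : ℝ≥0, P.real {ω | MGInfty.busyPeriod T S ω ≤ t} =
        1 - (lam + beta) / lam * (1 - Real.exp (-rho)) *
          Real.exp (-(Real.exp (-rho) * (lam + beta) * t))) ∧
      (-lam < beta →
        ∃ p : ℝ, p = (lam + beta) / lam * (1 - Real.exp (-rho)) ∧ 0 < p ∧ p ≤ 1 ∧
          HasLaw (fun ω => (MGInfty.busyPeriod T S ω).toReal)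
            (ENNReal.ofReal (1 - p) • Measure.dirac 0 +
              ENNReal.ofReal p • expMeasure (Real.exp (-rho) * (lam + beta))) P) ∧
      (beta = lam / (Real.exp rho - 1) →
        HasLaw (fun ω => (MGInfty.busyPeriod T S ω).toReal)
          (expMeasure (lam / (Real.exp rho - 1))) P) ∧
      (beta = -lam →
        HasLaw (fun ω => (MGInfty.busyPeriod T S ω).toReal) (Measure.dirac 0) P) := by
  refine ⟨MGInfty.exists_measure_serviceCDF hlam hrho hbeta₁ hbeta₂,
    fun t ht => MGInfty.hasDerivAt_serviceCDF hlam hrho ht,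
    MGInfty.integral_one_sub_serviceCDF hlam hrho,
    fun h t ht => MGInfty.serviceCDF_eq_one hlam hrho h ht, ?_⟩
  intro Ω _ P _ T S hQ
  refine ⟨hQ.ae_busyPeriod_ne_top hlam hrho hbeta₁,
    hQ.measureReal_busyPeriod_le hlam hrho hbeta₁, fun h => ⟨_, rfl, ?_, ?_, ?_⟩,
    hQ.hasLaw_busyPeriod_exp hlam hrho, hQ.hasLaw_busyPeriod_dirac hlam hrho⟩
  · exact mul_pos (div_pos (by linarith) hlam) (sub_pos.2 (MGInfty.exp_neg_lt_one hrho))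
  · exact MGInfty.le_of_le_div_exp_sub_one hlam hrho hbeta₂
  · exact hQ.hasLaw_busyPeriod hlam hrho h hbeta₂ rfl
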